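/- Let $K$ be a field, let $n,d$ be integers with $2\le d<n$, let $S=K[x_1,\dots,x_n]$ be the polynomial ring with graded maximal ideal $\mathfrak m=(x_1,\dots,x_n)$, and let $I=I_{n,d}\subset S$ be the squarefree Veronese ideal of degree $d$, that is, the ideal generated by all squarefree monomials of degree $d$ in $x_1,\dots,x_n$. Then for every integer $k\ge 1$, $$\operatorname{depth} S/I^k=\max\{\,0,\;n-k(n-d)-1\,\},$$ where $\operatorname{depth} M$ denotes the maximal length of an $M$-regular sequence of elements of $\mathfrak m$. -/

import Mathlib

open MvPolynomial

/-- The depth of an `R`-module `M` with respect to an ideal `J`: the supremum of the lengths of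
the `M`-regular sequences with all entries in `J`. (A regular sequence `r₁, …, rₘ` on `M`
satisfies `(r₁, …, rₘ) M ≠ M`.) -/
noncomputable def depthAt {R : Type*} [CommRing R] (J : Ideal R)
    (M : Type*) [AddCommGroup M] [Module R M] : ℕ∞ :=
  ⨆ (rs : List R) (_ : (∀ r ∈ rs, r ∈ J) ∧ RingTheory.Sequence.IsRegular M rs), (rs.length : ℕ∞)

/-- The graded maximal ideal `(x₁, …, xₙ)` of `K[x₁, …, xₙ]`. -/
noncomputable def gradedMaximalIdeal (K : Type*) [Field K] (n : ℕ) :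
    Ideal (MvPolynomial (Fin n) K) :=
  Ideal.span (Set.range X)

/-- The depth of a (nonzero, finitely generated graded) module over `S = K[x₁, …, xₙ]`, taken with
respect to the graded maximal ideal of `S`. -/
noncomputable def depth (K : Type*) [Field K] (n : ℕ) (M : Type*) [AddCommGroup M]
    [Module (MvPolynomial (Fin n) K) M] : ℕ∞ :=
  depthAt (gradedMaximalIdeal K n) M

/-- The squarefree Veronese ideal of degree `d` in the variables `x₁, …, xₙ`: the ideal of
`K[x₁, …, xₙ]` generated by all squarefree monomials of degree `d`, that is, by the products of
`d` distinct variables. -/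
noncomputable def squarefreeVeronese (K : Type*) [Field K] (n d : ℕ) :
    Ideal (MvPolynomial (Fin n) K) :=
  Ideal.span {u | ∃ s : Finset (Fin n), s.card = d ∧ u = ∏ i ∈ s, X i}

/-! The power `I^k` is a monomial ideal of Veronese type: a monomial `x^m` lies in it exactly when
`∑ min(m_i, k) ≥ k d` (`squarefreeVeronese_pow_eq`). Both bounds on the depth are read off from this
description.

Lower bound: the ideals `veroneseTypeIdeal K A a D` are closed under colon by a variable and under
adding a variable, so the sequences `0 → S/(J : x) → S/J → S/(J, x) → 0` reduce everything to
quotients by sets of variables. To glue regularity along them, one fixed sequence must work on every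
such quotient; the complete homogeneous polynomials `h_1, …, h_t` do, because killing variables
turns them into the same polynomials in the remaining variables, where at most as many consecutive
ones as there are variables form a regular sequence (`isWeaklyRegular_completeHomogeneous`).

Upper bound: a regular sequence in a prime `m` is no longer than `dim S/p` for every associated
prime `p ≤ m` (`length_le_ringKrullDim_quotient_of_isWeaklyRegular`), and an explicit monomial shows
that a prime generated by `min(n, k(n-d)+1)` variables is associated to `S/I^k`
(`span_X_image_mem_associatedPrimes`). -/

/-! ### Regular sequences: extensions, and the bound by dimensions of associated primes. -/

section RegularSequences

open RingTheory.Sequence Pointwise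

/-- In a short exact sequence, a sequence that is weakly regular on the outer terms is weakly
regular on the middle term. -/
theorem isWeaklyRegular_of_exact {R : Type*} [CommRing R] (rs : List R) :
    ∀ {M' M M'' : Type*} [AddCommGroup M'] [AddCommGroup M] [AddCommGroup M'']
      [Module R M'] [Module R M] [Module R M''] {f : M' →ₗ[R] M} {g : M →ₗ[R] M''},
      Function.Injective f → Function.Exact f g → Function.Surjective g →
      IsWeaklyRegular M' rs → IsWeaklyRegular M'' rs → IsWeaklyRegular M rs := by
  induction rs with
  | nil => intros; exact IsWeaklyRegular.nil _ _
  | cons r rs ih =>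
    intro M' M M'' _ _ _ _ _ _ f g hf hfg hg h' h''
    rw [isWeaklyRegular_cons_iff] at h' h'' ⊢
    refine ⟨isSMulRegular_of_range_eq_ker hf (LinearMap.exact_iff.mp hfg).symm h'.1 h''.1, ?_⟩
    -- Injectivity of `f` is recast as exactness at `M'`; as `r` is regular on `M''`, this exactness
    -- survives reduction modulo `r`.
    have hz : Function.Exact (0 : PUnit →ₗ[R] M') f := by
      rw [LinearMap.exact_iff, LinearMap.ker_eq_bot.mpr hf, LinearMap.range_zero]
    have h := QuotSMulTop.map_first_exact_on_four_term_exact_of_isSMulRegular_last hz hfg h''.1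
    refine ih ?_ (QuotSMulTop.map_exact r hfg hg) (QuotSMulTop.map_surjective r hg) h'.2 h''.2
    rw [← LinearMap.ker_eq_bot, LinearMap.exact_iff.mp h, map_zero, LinearMap.range_zero]

theorem isWeaklyRegular_of_subsingleton {R M : Type*} [CommRing R] [AddCommGroup M] [Module R M]
    [Subsingleton M] (rs : List R) : IsWeaklyRegular M rs := by
  induction rs generalizing M with
  | nil => exact IsWeaklyRegular.nil _ _
  | cons r rs ih =>
    exact (isWeaklyRegular_cons_iff _ _ _).mpr ⟨fun _ _ _ => Subsingleton.elim _ _, ih⟩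

/-- If `s • N ⊆ x • N` for a finite module `N`, then `s` lies in every prime ideal containing `x`
and the annihilator of some element of `N`. -/
theorem Ideal.IsPrime.mem_of_smul_range_le {R N : Type*} [CommRing R] [AddCommGroup N] [Module R N]
    [Module.Finite R N] {m : Ideal R} (hm : m.IsPrime) {x s : R} (hx : x ∈ m)
    {w : N} (hw : ∀ a : R, a • w = 0 → a ∈ m) (hs : ∀ y : N, ∃ z : N, s • y = x • z) : s ∈ m := by
  -- Cayley–Hamilton: a monic `P` with lower coefficients in `(x)` has `P(s)` killing `N`, so a
  -- power of `s` lies in `m`.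
  obtain ⟨P, hP, -, hcoeff, hP0⟩ :=
    LinearMap.exists_monic_and_natDegree_eq_and_coeff_mem_pow_and_aeval_eq_zero R
      (algebraMap R (Module.End R N) s) (Ideal.span {x}) (by
        rintro _ ⟨y, rfl⟩
        obtain ⟨z, hz⟩ := hs y
        rw [Module.algebraMap_end_apply, hz]
        exact Submodule.smul_mem_smul (Ideal.mem_span_singleton_self x) trivial)
  rw [Polynomial.aeval_algebraMap_apply, Polynomial.coe_aeval_eq_eval] at hP0
  have hPs : P.eval s ∈ m := hw _ (by
    simpa using congrArg (fun φ : Module.End R N => φ w) hP0)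
  rw [Polynomial.eval_eq_sum_range, Finset.sum_range_succ, hP.coeff_natDegree, one_mul] at hPs
  have hsum : ∑ i ∈ Finset.range P.natDegree, P.coeff i * s ^ i ∈ m := by
    refine Ideal.sum_mem _ fun i hi => Ideal.mul_mem_right _ _ ?_
    have hlt : P.natDegree - i ≠ 0 := by have := Finset.mem_range.mp hi; omega
    exact (Ideal.span_singleton_le_iff_mem _).mpr hx (Ideal.pow_le_self hlt (hcoeff i))
  exact hm.mem_of_pow_mem _ ((Ideal.add_mem_iff_right _ hsum).mp hPs)

/-- Dividing by a regular element of a prime ideal `m` strictly enlarges associated primes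
inside `m`. -/
theorem exists_lt_associatedPrime_quotSMulTop {R M : Type*} [CommRing R] [IsNoetherianRing R]
    [AddCommGroup M] [Module R M] [Module.Finite R M] {m p : Ideal R} (hm : m.IsPrime)
    (hp : p ∈ associatedPrimes R M) (hpm : p ≤ m) {x : R} (hx : x ∈ m) (hreg : IsSMulRegular M x) :
    ∃ q ∈ associatedPrimes R (QuotSMulTop x M), p < q ∧ q ≤ m := by
  obtain ⟨hpp, w, hw⟩ := isAssociatedPrime_iff.mp hp
  have hw' : ∀ a : R, a ∈ p ↔ a • w = 0 := fun a => by
    rw [hw, Submodule.mem_colon_singleton, Submodule.mem_bot]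
  let N : Submodule R M := Submodule.torsionBySet R M p
  have hN : ∀ y : M, y ∈ N ↔ ∀ a ∈ p, a • y = 0 := fun y => by
    simp [N, Submodule.mem_torsionBySet_iff]
  -- `N` consists of the elements killed by `p`. Its image `Q` in `M/xM` is killed by both `p` and
  -- `x`, so any prime over the annihilator of `Q` contains `p` and `x`.
  let Q := N.map (x • (⊤ : Submodule R M)).mkQ
  have hQ : Module.annihilator R Q ≤ m := by
    intro s hs
    refine hm.mem_of_smul_range_le (N := N) hx
      (w := ⟨w, (hN w).mpr fun a ha => (hw' a).mp ha⟩) (fun a ha => hpm ((hw' a).mpr ?_)) ?_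
    · simpa using congrArg Subtype.val ha
    · rintro ⟨y, hy⟩
      have h1 := Module.mem_annihilator.mp hs ⟨_, Submodule.mem_map_of_mem hy⟩
      have h2 : (x • (⊤ : Submodule R M)).mkQ (s • y) = 0 := by
        rw [map_smul]; exact congrArg Subtype.val h1
      rw [Submodule.mkQ_apply, Submodule.Quotient.mk_eq_zero,
        Submodule.mem_smul_pointwise_iff_exists] at h2
      obtain ⟨z, -, hz⟩ := h2
      -- Here `N ∩ xM = xN`: if `p` kills `x z`, it kills `z` by regularity of `x`.
      refine ⟨⟨z, (hN z).mpr fun a ha => hreg ?_⟩, Subtype.ext hz.symm⟩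
      change x • a • z = x • 0
      rw [smul_comm, hz, smul_comm, (hN y).mp hy a ha, smul_zero, smul_zero]
  obtain ⟨q, hq, hqm⟩ := Ideal.exists_minimalPrimes_le hQ
  refine ⟨q, associatedPrimes.subset_of_injective (f := Q.subtype) Q.injective_subtype
    (Module.associatedPrimes.minimalPrimes_annihilator_subset_associatedPrimes R Q hq), ?_, hqm⟩
  have hann : ∀ a : R, (∀ y ∈ N, a • y ∈ x • (⊤ : Submodule R M)) → a ∈ q := by
    refine fun a ha => hq.1.2 (Module.mem_annihilator.mpr ?_)
    rintro ⟨_, y, hy, rfl⟩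
    refine Subtype.ext ?_
    change a • (x • (⊤ : Submodule R M)).mkQ y = 0
    rw [← map_smul, Submodule.mkQ_apply, Submodule.Quotient.mk_eq_zero]
    exact ha y hy
  refine lt_of_le_of_ne (fun a ha => hann a fun y hy => ?_) ?_
  · rw [(hN y).mp hy a ha]; exact zero_mem _
  · rintro rfl
    have hxp : x ∈ p := hann x fun y _ => Submodule.smul_mem_pointwise_smul _ _ _ trivial
    have hw0 : w = 0 := hreg.right_eq_zero_of_smul ((hw' x).mp hxp)
    exact hpp.ne_top ((Ideal.eq_top_iff_one _).mpr ((hw' 1).mpr (by rw [hw0, smul_zero])))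

/-- Each term of the sequence replaces the associated prime by a strictly larger one, which produces
a chain of primes above `p`. -/
theorem length_le_coheight_of_isWeaklyRegular {R : Type*} [CommRing R] [IsNoetherianRing R]
    {m : Ideal R} (hm : m.IsPrime) (rs : List R) :
    ∀ {M : Type*} [AddCommGroup M] [Module R M] [Module.Finite R M] (p : PrimeSpectrum R),
      p.asIdeal ∈ associatedPrimes R M → p.asIdeal ≤ m → (∀ r ∈ rs, r ∈ m) →
      IsWeaklyRegular M rs → (rs.length : ℕ∞) ≤ Order.coheight p := by
  induction rs with
  | nil => intros; simp
  | cons r rs ih =>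
    intro M _ _ _ p hp hpm hrs hreg
    rw [isWeaklyRegular_cons_iff] at hreg
    obtain ⟨q, hq, hpq, hqm⟩ :=
      exists_lt_associatedPrime_quotSMulTop hm hp hpm (hrs r List.mem_cons_self) hreg.1
    have h := ih ⟨q, hq.isPrime⟩ hq hqm (fun a ha => hrs a (List.mem_cons_of_mem _ ha)) hreg.2
    have hlt : p < ⟨q, hq.isPrime⟩ := hpq
    rw [List.length_cons, Nat.cast_succ]
    exact (add_le_add_left h 1).trans (Order.coheight_add_one_le hlt)

/-- The length of a regular sequence inside a prime ideal is at most the dimension of the ring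
modulo any associated prime contained in this ideal. -/
theorem length_le_ringKrullDim_quotient_of_isWeaklyRegular {R M : Type*} [CommRing R]
    [IsNoetherianRing R] [AddCommGroup M] [Module R M] [Module.Finite R M] {m p : Ideal R}
    (hm : m.IsPrime) (hp : p ∈ associatedPrimes R M) (hpm : p ≤ m) {rs : List R}
    (hrs : ∀ r ∈ rs, r ∈ m) (hreg : IsWeaklyRegular M rs) :
    ((rs.length : ℕ∞) : WithBot ℕ∞) ≤ ringKrullDim (R ⧸ p) := by
  have h := length_le_coheight_of_isWeaklyRegular hm rs ⟨p, hp.isPrime⟩ hp hpm hrs hreg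
  refine (WithBot.coe_le_coe.mpr h).trans ?_
  rw [ringKrullDim_quotient, Order.coheight_eq_krullDim_Ici]
  exact le_rfl

end RegularSequences

/-! ### Complete homogeneous symmetric polynomials form regular sequences. -/

section CompleteHomogeneous

variable {R : Type*} [CommRing R]

/-- The complete homogeneous symmetric polynomial of degree `s` evaluated at a finite family `x`,
defined through its generating function `∏ i, 1 / (1 - x i * T)`. -/
noncomputable def completeHomogeneous {ι : Type*} [Fintype ι] (x : ι → R) (s : ℕ) : R :=
  PowerSeries.coeff s (∏ i, PowerSeries.mk fun k => x i ^ k)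

theorem map_completeHomogeneous {R' ι : Type*} [CommRing R'] [Fintype ι] (φ : R →+* R') (x : ι → R)
    (s : ℕ) : φ (completeHomogeneous x s) = completeHomogeneous (fun i => φ (x i)) s := by
  unfold completeHomogeneous
  rw [← PowerSeries.coeff_map, map_prod]
  congr 1
  refine Finset.prod_congr rfl fun i _ => ?_
  ext k
  simp

theorem completeHomogeneous_zero {ι : Type*} [Fintype ι] (x : ι → R) :
    completeHomogeneous x 0 = 1 := by
  simp [completeHomogeneous, PowerSeries.coeff_zero_eq_constantCoeff, map_prod,
    ← PowerSeries.coeff_zero_eq_constantCoeff_apply]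

theorem PowerSeries.mk_zero_pow : (PowerSeries.mk fun k => (0 : R) ^ k) = 1 := by
  ext k
  rw [PowerSeries.coeff_mk, PowerSeries.coeff_one, zero_pow_eq]

/-- A zero entry contributes the factor `1` to the generating function. This is what lets one
sequence serve all quotients by sets of variables. -/
theorem completeHomogeneous_comp_of_injective {ι κ : Type*} [Fintype ι] [Fintype κ] (x : ι → R)
    {f : κ → ι} (hf : Function.Injective f) (hx : ∀ i ∉ Set.range f, x i = 0) (s : ℕ) :
    completeHomogeneous (fun j => x (f j)) s = completeHomogeneous x s := by
  unfold completeHomogeneous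
  congr 1
  refine Fintype.prod_of_injective f hf _ _ (fun i hi => ?_) fun _ => rfl
  rw [hx i hi, PowerSeries.mk_zero_pow]

theorem completeHomogeneous_mem {ι : Type*} [Fintype ι] {x : ι → R} {J : Ideal R}
    (hx : ∀ i, x i ∈ J) (s : ℕ) : completeHomogeneous x (s + 1) ∈ J := by
  rw [← Ideal.Quotient.eq_zero_iff_mem, map_completeHomogeneous, completeHomogeneous]
  simp_rw [Ideal.Quotient.eq_zero_iff_mem.mpr (hx _), PowerSeries.mk_zero_pow]
  simp [PowerSeries.coeff_one]

theorem completeHomogeneous_cons_succ {m : ℕ} (z : R) (y : Fin m → R) (s : ℕ) :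
    completeHomogeneous (Fin.cons z y : Fin (m + 1) → R) (s + 1) =
      completeHomogeneous y (s + 1) +
        z * completeHomogeneous (Fin.cons z y : Fin (m + 1) → R) s := by
  unfold completeHomogeneous
  rw [Fin.prod_univ_succ]
  simp only [Fin.cons_zero, Fin.cons_succ]
  -- The geometric series satisfies `G = 1 + z T G`; comparing coefficients gives the recursion.
  have h : (PowerSeries.mk fun k => z ^ k) =
      1 + PowerSeries.C z * (PowerSeries.X * PowerSeries.mk fun k => z ^ k) := by
    ext k
    cases k with
    | zero => simp
    | succ k => simp [pow_succ', PowerSeries.coeff_succ_X_mul, PowerSeries.coeff_one]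
  conv_lhs => rw [h]
  rw [add_mul, one_mul, map_add, mul_assoc, mul_assoc, PowerSeries.coeff_C_mul,
    PowerSeries.coeff_succ_X_mul]

open Polynomial in
theorem monic_completeHomogeneous_cons [Nontrivial R] {m : ℕ} (y : Fin m → R) (s : ℕ) :
    (completeHomogeneous (Fin.cons Polynomial.X fun j => Polynomial.C (y j) :
      Fin (m + 1) → R[X]) s).Monic ∧
    (completeHomogeneous (Fin.cons Polynomial.X fun j => Polynomial.C (y j) :
      Fin (m + 1) → R[X]) s).natDegree = s := by
  induction s with
  | zero => rw [completeHomogeneous_zero]; exact ⟨Polynomial.monic_one, Polynomial.natDegree_one⟩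
  | succ s ih =>
    rw [completeHomogeneous_cons_succ, ← map_completeHomogeneous (Polynomial.C : R →+* R[X])]
    have hmon := Polynomial.monic_X.mul ih.1
    have hdeg : (Polynomial.X * completeHomogeneous (Fin.cons Polynomial.X fun j => Polynomial.C (y j) :
        Fin (m + 1) → R[X]) s).natDegree = s + 1 := by
      rw [Polynomial.monic_X.natDegree_mul ih.1, ih.2, Polynomial.natDegree_X, add_comm]
    have hlt : (Polynomial.C (completeHomogeneous y (s + 1))).degree <
        (Polynomial.X * completeHomogeneous (Fin.cons Polynomial.X fun j => Polynomial.C (y j) :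
        Fin (m + 1) → R[X]) s).degree := by
      rw [Polynomial.degree_eq_natDegree hmon.ne_zero, hdeg]
      exact Polynomial.degree_C_le.trans_lt (by exact_mod_cast Nat.succ_pos s)
    refine ⟨hmon.add_of_right hlt, ?_⟩
    rw [Polynomial.natDegree_add_eq_right_of_degree_lt hlt, hdeg]

open RingTheory.Sequence Pointwise

/-- Two sequences related by `b (j + 1) = c (j + 1) + z * b j` are simultaneously weakly regular on
a module killed by the initial term of `b`. -/
theorem isWeaklyRegular_map_range'_of_recursion (z : R) (b c : ℕ → R)
    (hbc : ∀ j, b (j + 1) = c (j + 1) + z * b j) (t : ℕ) :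
    ∀ (s : ℕ) {M : Type*} [AddCommGroup M] [Module R M], (∀ y : M, b s • y = 0) →
      IsWeaklyRegular M ((List.range' (s + 1) t).map c) →
      IsWeaklyRegular M ((List.range' (s + 1) t).map b) := by
  induction t with
  | zero => intros; exact IsWeaklyRegular.nil _ _
  | succ t ih =>
    intro s M _ _ hs h
    rw [List.range'_succ, List.map_cons, isWeaklyRegular_cons_iff] at h ⊢
    -- As `b s` acts by zero, the recursion makes the next terms of `b` and `c` act identically; the
    -- quotient by them is then killed by `b (s + 1)`, and the argument repeats.
    have hact : ∀ y : M, b (s + 1) • y = c (s + 1) • y := fun y => by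
      rw [hbc, add_smul, mul_smul, hs, smul_zero, add_zero]
    have htop : c (s + 1) • (⊤ : Submodule R M) = b (s + 1) • (⊤ : Submodule R M) := by
      ext y
      simp only [Submodule.mem_smul_pointwise_iff_exists, hact]
    refine ⟨fun y y' hy => h.1 (by simpa [hact] using hy), ih (s + 1) (fun y => ?_) ?_⟩
    · obtain ⟨y, rfl⟩ := Submodule.Quotient.mk_surjective _ y
      rw [← Submodule.Quotient.mk_smul, Submodule.Quotient.mk_eq_zero]
      exact Submodule.smul_mem_pointwise_smul _ _ _ trivial
    · exact ((Submodule.quotEquivOfEq _ _ htop).isWeaklyRegular_congr _).mp h.2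

open Polynomial in
-- The first term is monic in the new variable, hence regular with quotient free over `R`. Modulo
-- it, the recursion trades the remaining terms for those in the old variables, which stay weakly
-- regular by flatness.
theorem isWeaklyRegular_completeHomogeneous_cons [Nontrivial R] {m : ℕ} (y : Fin m → R) (s t : ℕ)
    (h : IsWeaklyRegular R ((List.range' (s + 1) t).map (completeHomogeneous y))) :
    IsWeaklyRegular R[X] ((List.range' s (t + 1)).map
      (completeHomogeneous (Fin.cons Polynomial.X fun j => Polynomial.C (y j) :
        Fin (m + 1) → R[X]))) := by
  set b := completeHomogeneous (Fin.cons Polynomial.X fun j => Polynomial.C (y j) :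
        Fin (m + 1) → R[X]) with hb
  have hmon : (b s).Monic := (monic_completeHomogeneous_cons y s).1
  rw [List.range'_succ, List.map_cons, isWeaklyRegular_cons_iff]
  refine ⟨fun p q hpq => hmon.isRegular.left hpq, ?_⟩
  have htop : Ideal.span {b s} = b s • (⊤ : Submodule R[X] R[X]) := by
    rw [← Submodule.ideal_span_singleton_smul, smul_eq_mul, Ideal.mul_top]
  refine ((Submodule.quotEquivOfEq _ _ htop).isWeaklyRegular_congr _).mp ?_
  refine isWeaklyRegular_map_range'_of_recursion Polynomial.X b
    (fun j => Polynomial.C (completeHomogeneous y j))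
    (fun j => ?_) t s (fun p => ?_) ?_
  · rw [hb, completeHomogeneous_cons_succ, map_completeHomogeneous]
  · obtain ⟨p, rfl⟩ := Submodule.Quotient.mk_surjective _ p
    rw [← Submodule.Quotient.mk_smul, Submodule.Quotient.mk_eq_zero]
    exact Ideal.mul_mem_right _ _ (Ideal.mem_span_singleton_self _)
  · have : Module.Free R (AdjoinRoot (b s)) := hmon.free_adjoinRoot
    have hflat := (isWeaklyRegular_map_algebraMap_iff _ _ _).mp (h.of_flat (S := AdjoinRoot (b s)))
    have hR : IsWeaklyRegular (R[X] ⧸ Ideal.span {b s})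
        ((List.range' (s + 1) t).map (completeHomogeneous y)) := hflat
    have := (isWeaklyRegular_map_algebraMap_iff R[X] (R[X] ⧸ Ideal.span {b s}) _).mpr hR
    rwa [List.map_map] at this

theorem isWeaklyRegular_completeHomogeneous_fin [Nontrivial R] (m : ℕ) :
    ∀ s t : ℕ, t ≤ m → IsWeaklyRegular (MvPolynomial (Fin m) R)
      ((List.range' s t).map (completeHomogeneous (X : Fin m → MvPolynomial (Fin m) R))) := by
  induction m with
  | zero =>
    intro s t ht
    obtain rfl : t = 0 := by omega
    exact IsWeaklyRegular.nil _ _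
  | succ m ih =>
    intro s t ht
    cases t with
    | zero => exact IsWeaklyRegular.nil _ _
    | succ t =>
      have h := isWeaklyRegular_completeHomogeneous_cons _ s t (ih (s + 1) t (by omega))
      refine ((finSuccEquiv R m).toAddEquiv.isWeaklyRegular_congr ?_).mpr h
      refine List.forall₂_map_left_iff.mpr <| List.forall₂_map_right_iff.mpr <|
        List.forall₂_same.mpr fun j _ p => ?_
      have hX : (fun i => finSuccEquiv R m (X i)) =
          (Fin.cons Polynomial.X fun j => Polynomial.C (X j)) := by
        funext i
        refine Fin.cases ?_ (fun i => ?_) i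
        · simp [finSuccEquiv_X_zero]
        · simp [finSuccEquiv_X_succ]
      have := map_completeHomogeneous (finSuccEquiv R m).toRingEquiv.toRingHom X j
      change finSuccEquiv R m _ = _ at this
      change finSuccEquiv R m (_ * p) = _ * finSuccEquiv R m p
      rw [map_mul, this, ← hX]
      rfl

/-- Consecutive complete homogeneous symmetric polynomials, no more than there are variables,
form a weakly regular sequence. -/
theorem isWeaklyRegular_completeHomogeneous [Nontrivial R] {ι : Type*} [Fintype ι] (s t : ℕ)
    (ht : t ≤ Fintype.card ι) : IsWeaklyRegular (MvPolynomial ι R)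
      ((List.range' s t).map (completeHomogeneous (X : ι → MvPolynomial ι R))) := by
  let e := Fintype.equivFin ι
  refine ((renameEquiv R e).toAddEquiv.isWeaklyRegular_congr ?_).mpr
    (isWeaklyRegular_completeHomogeneous_fin (Fintype.card ι) s t ht)
  refine List.forall₂_map_left_iff.mpr <| List.forall₂_map_right_iff.mpr <|
    List.forall₂_same.mpr fun j _ p => ?_
  have h := map_completeHomogeneous (renameEquiv R e).toRingEquiv.toRingHom X j
  change renameEquiv R e _ = completeHomogeneous (fun i => renameEquiv R e (X i)) j at h
  have h' := completeHomogeneous_comp_of_injective (X : _ → MvPolynomial (Fin (Fintype.card ι)) R)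
    e.injective (fun i hi => (hi (e.surjective i)).elim) j
  change renameEquiv R e (_ * p) = _ * renameEquiv R e p
  rw [map_mul, h, ← h']
  simp

end CompleteHomogeneous

/-! ### Monomial ideals and quotients by sets of variables. -/

section MonomialIdeals

variable {σ K : Type*} [Field K]

theorem mem_restrictSupportIdeal {s : Set (σ →₀ ℕ)} {hs : IsUpperSet s} {f : MvPolynomial σ K} :
    f ∈ restrictSupportIdeal K s hs ↔ ∀ m ∈ f.support, m ∈ s := Iff.rfl

theorem mul_monomial_mem_restrictSupportIdeal {s : Set (σ →₀ ℕ)} {hs : IsUpperSet s}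
    {f : MvPolynomial σ K} (w : σ →₀ ℕ) :
    f * monomial w 1 ∈ restrictSupportIdeal K s hs ↔ ∀ m ∈ f.support, m + w ∈ s := by
  classical
  rw [mem_restrictSupportIdeal]
  refine ⟨fun h m hm => h _ ?_, fun h m hm => ?_⟩
  · rw [mem_support_iff, coeff_mul_monomial, mul_one]
    exact mem_support_iff.mp hm
  · rw [mem_support_iff, coeff_mul_monomial', mul_one] at hm
    split_ifs at hm with hw
    · simpa [tsub_add_cancel_of_le hw] using h _ (mem_support_iff.mpr hm)
    · exact absurd rfl hm

theorem mem_span_X_image_iff_killCompl_eq_zero (A : Finset σ) (f : MvPolynomial σ K) :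
    f ∈ Ideal.span (X '' (A : Set σ)) ↔
      killCompl (Subtype.val_injective : Function.Injective (Subtype.val : {i // i ∉ A} → σ)) f
        = 0 := by
  rw [mem_ideal_span_X_image]
  refine ⟨fun h => ?_, fun h m hm => ?_⟩
  · ext s
    rw [coeff_killCompl, coeff_zero]
    by_contra hs
    obtain ⟨i, hi, hne⟩ := h _ (mem_support_iff.mpr hs)
    refine hne (Finsupp.mapDomain_of_notMem_range _ _ ?_)
    rintro ⟨j, rfl⟩
    exact j.2 hi
  · by_contra hA
    push Not at hA
    have hsub : (m.support : Set σ) ⊆ Set.range (Subtype.val : {i // i ∉ A} → σ) := fun i hi => by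
      refine ⟨⟨i, fun hiA => ?_⟩, rfl⟩
      exact Finsupp.mem_support_iff.mp hi (hA i hiA)
    have hcoeff := congrArg (coeff (m.comapDomain Subtype.val Subtype.val_injective.injOn)) h
    rw [coeff_killCompl, Finsupp.mapDomain_comapDomain _ Subtype.val_injective _ hsub,
      coeff_zero] at hcoeff
    exact mem_support_iff.mp hm hcoeff

theorem ker_killCompl_eq_span_X_image (A : Finset σ) :
    RingHom.ker (killCompl (R := K)
      (Subtype.val_injective : Function.Injective (Subtype.val : {i // i ∉ A} → σ))).toRingHom =
      Ideal.span (X '' (A : Set σ)) := by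
  ext f
  rw [mem_span_X_image_iff_killCompl_eq_zero]
  rfl

/-- Killing the variables in `A` leaves the polynomial ring in the other variables. -/
noncomputable def quotientSpanXEquiv (A : Finset σ) :
    (MvPolynomial σ K ⧸ (Ideal.span (X '' (A : Set σ)) : Ideal (MvPolynomial σ K))) ≃+*
      MvPolynomial {i // i ∉ A} K :=
  (Ideal.quotEquivOfEq (ker_killCompl_eq_span_X_image A).symm).trans
    (RingHom.quotientKerEquivOfSurjective (f := (killCompl (R := K)
      (Subtype.val_injective : Function.Injective
        (Subtype.val : {i // i ∉ A} → σ))).toRingHom)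
      fun f => ⟨rename Subtype.val f, killCompl_rename_app _ f⟩)

theorem quotientSpanXEquiv_mk (A : Finset σ) (f : MvPolynomial σ K) :
    quotientSpanXEquiv A (Ideal.Quotient.mk _ f) =
      killCompl (Subtype.val_injective : Function.Injective (Subtype.val : {i // i ∉ A} → σ)) f :=
  rfl

theorem isPrime_span_X_image (A : Finset σ) :
    (Ideal.span (X '' (A : Set σ)) : Ideal (MvPolynomial σ K)).IsPrime := by
  rw [← ker_killCompl_eq_span_X_image]
  exact RingHom.ker_isPrime _

theorem ringKrullDim_quotient_span_X_image [Fintype σ] (A : Finset σ) :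
    ringKrullDim (MvPolynomial σ K ⧸
      (Ideal.span (X '' (A : Set σ)) : Ideal (MvPolynomial σ K))) =
        ((Fintype.card σ - A.card : ℕ) : WithBot ℕ∞) := by
  classical
  rw [ringKrullDim_eq_of_ringEquiv (quotientSpanXEquiv A),
    MvPolynomial.ringKrullDim_of_isNoetherianRing, ringKrullDim_eq_zero_of_field, zero_add,
    Nat.card_eq_fintype_card, Fintype.card_subtype_compl, Fintype.card_coe]

open RingTheory.Sequence

theorem isWeaklyRegular_quotient_span_X_image [Fintype σ] (A : Finset σ) (s t : ℕ)
    (ht : t + A.card ≤ Fintype.card σ) :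
    IsWeaklyRegular (MvPolynomial σ K ⧸
      (Ideal.span (X '' (A : Set σ)) : Ideal (MvPolynomial σ K)))
      ((List.range' s t).map (completeHomogeneous (X : σ → MvPolynomial σ K))) := by
  classical
  have hcard : t ≤ Fintype.card {i // i ∉ A} := by
    rw [Fintype.card_subtype_compl, Fintype.card_coe]; omega
  refine ((quotientSpanXEquiv A).toAddEquiv.isWeaklyRegular_congr ?_).mpr
    (isWeaklyRegular_completeHomogeneous s t hcard)
  refine List.forall₂_map_left_iff.mpr <| List.forall₂_map_right_iff.mpr <|
    List.forall₂_same.mpr fun j _ p => ?_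
  obtain ⟨p, rfl⟩ := Ideal.Quotient.mk_surjective p
  have hinj := (Subtype.val_injective : Function.Injective (Subtype.val : {i // i ∉ A} → σ))
  have h := map_completeHomogeneous (killCompl (R := K) hinj).toRingHom X j
  rw [← completeHomogeneous_comp_of_injective
    (fun i => (killCompl (R := K) hinj).toRingHom (X i)) hinj] at h
  · have hX : (fun i : {i // i ∉ A} => (killCompl (R := K) hinj).toRingHom (X i.val)) = X := by
      funext i
      change killCompl hinj (X i.val) = X i
      rw [← rename_X Subtype.val, killCompl_rename_app]
    replace h := h.trans (congrArg (fun x => completeHomogeneous x j) hX)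
    change quotientSpanXEquiv A (Ideal.Quotient.mk _ (_ * p)) =
      _ * quotientSpanXEquiv A (Ideal.Quotient.mk _ p)
    rw [quotientSpanXEquiv_mk, quotientSpanXEquiv_mk, map_mul]
    congr 1
  · intro i hi
    refine (mem_span_X_image_iff_killCompl_eq_zero A _).mp (Ideal.subset_span ⟨i, ?_, rfl⟩)
    by_contra hiA
    exact hi ⟨⟨i, hiA⟩, rfl⟩

/-- Regularity passes from `S / (J : x)` and `S / (J, x)` to `S / J`. -/
theorem isWeaklyRegular_quotient_of_colon {R : Type*} [CommRing R] {J J₁ J₂ : Ideal R} {x : R}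
    (h₁ : ∀ f, f ∈ J₁ ↔ f * x ∈ J) (h₂ : J₂ = J ⊔ Ideal.span {x}) {rs : List R}
    (hr₁ : IsWeaklyRegular (R ⧸ J₁) rs) (hr₂ : IsWeaklyRegular (R ⧸ J₂) rs) :
    IsWeaklyRegular (R ⧸ J) rs := by
  have hle : J ≤ J₂ := h₂ ▸ le_sup_left
  let f : (R ⧸ J₁) →ₗ[R] (R ⧸ J) := Submodule.mapQ J₁ J (LinearMap.mulRight R x)
    fun a ha => (h₁ a).mp ha
  let g : (R ⧸ J) →ₗ[R] (R ⧸ J₂) := Submodule.mapQ J J₂ LinearMap.id hle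
  refine isWeaklyRegular_of_exact rs (f := f) (g := g) ?_ ?_ ?_ hr₁ hr₂
  · rw [← LinearMap.ker_eq_bot, LinearMap.ker_eq_bot']
    intro a ha
    obtain ⟨a, rfl⟩ := Submodule.Quotient.mk_surjective _ a
    exact (Submodule.Quotient.mk_eq_zero _).mpr
      ((h₁ a).mpr ((Submodule.Quotient.mk_eq_zero J).mp ha))
  · intro b
    obtain ⟨b, rfl⟩ := Submodule.Quotient.mk_surjective _ b
    constructor
    · intro hb
      have hb' : b ∈ J ⊔ Ideal.span {x} := h₂ ▸ (Submodule.Quotient.mk_eq_zero J₂).mp hb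
      obtain ⟨y, hy, z, hz, rfl⟩ := Submodule.mem_sup.mp hb'
      obtain ⟨a, rfl⟩ := Ideal.mem_span_singleton'.mp hz
      refine ⟨Submodule.Quotient.mk a, ((Submodule.Quotient.eq J).mpr ?_)⟩
      change a * x - (y + a * x) ∈ J
      rw [sub_add_cancel_right]
      exact J.neg_mem hy
    · rintro ⟨a, ha⟩
      obtain ⟨a, rfl⟩ := Submodule.Quotient.mk_surjective _ a
      rw [← ha]
      refine (Submodule.Quotient.mk_eq_zero J₂).mpr ?_
      rw [h₂]
      exact Ideal.mem_sup_right (Ideal.mul_mem_left _ _ (Ideal.mem_span_singleton_self x))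
  · intro c
    obtain ⟨c, rfl⟩ := Submodule.Quotient.mk_surjective _ c
    exact ⟨Submodule.Quotient.mk c, rfl⟩

/-! ### Ideals of Veronese type. -/

variable [Fintype σ] [DecidableEq σ]

/-- The exponents of the monomials which are divisible by a variable in `A`, or whose truncation
by `a` outside of `A` has degree at least `D`. -/
def veroneseExponents (A : Finset σ) (a : σ → ℕ) (D : ℕ) : Set (σ →₀ ℕ) :=
  {m | (∃ i ∈ A, m i ≠ 0) ∨ D ≤ ∑ i ∈ Aᶜ, min (m i) (a i)}

theorem isUpperSet_veroneseExponents (A : Finset σ) (a : σ → ℕ) (D : ℕ) :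
    IsUpperSet (veroneseExponents A a D) := by
  rintro m m' hm (⟨i, hi, h⟩ | h)
  · exact Or.inl ⟨i, hi, fun h0 => h (Nat.le_zero.mp (h0 ▸ hm i))⟩
  · exact Or.inr (h.trans (Finset.sum_le_sum fun i _ => min_le_min_right _ (hm i)))

variable (K) in
/-- The sum of the ideal generated by the variables in `A` and the ideal of Veronese type generated
by the monomials of degree `D` in the other variables with exponents bounded by `a`. -/
noncomputable def veroneseTypeIdeal (A : Finset σ) (a : σ → ℕ) (D : ℕ) :
    Ideal (MvPolynomial σ K) :=
  restrictSupportIdeal K (veroneseExponents A a D) (isUpperSet_veroneseExponents A a D)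

theorem veroneseTypeIdeal_eq_span_X_image {A : Finset σ} {a : σ → ℕ} {D : ℕ}
    (h : ∑ i ∈ Aᶜ, a i < D) : veroneseTypeIdeal K A a D = Ideal.span (X '' (A : Set σ)) := by
  ext f
  rw [mem_ideal_span_X_image, veroneseTypeIdeal, mem_restrictSupportIdeal]
  refine forall₂_congr fun m _ => or_iff_left ?_
  rw [not_le]
  exact (Finset.sum_le_sum fun i _ => min_le_right _ _).trans_lt h

/-- For `a_i ≥ 1` one has `min(m_i + 1, a_i) = min(m_i, a_i - 1) + 1`, so the bound at `i` and the
degree drop together. -/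
theorem mem_veroneseTypeIdeal_colon_X {A : Finset σ} {a : σ → ℕ} {D : ℕ} {i : σ} (hi : i ∉ A)
    (hai : a i ≠ 0) (f : MvPolynomial σ K) :
    f ∈ veroneseTypeIdeal K A (Function.update a i (a i - 1)) D ↔
      f * X i ∈ veroneseTypeIdeal K A a (D + 1) := by
  rw [veroneseTypeIdeal, veroneseTypeIdeal, X, mul_monomial_mem_restrictSupportIdeal,
    mem_restrictSupportIdeal]
  refine forall₂_congr fun m _ => or_congr (exists_congr fun j => and_congr_right fun hj => ?_) ?_
  · rw [Finsupp.add_apply, Finsupp.single_eq_of_ne (by rintro rfl; exact hi hj), add_zero]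
  · have hi' : i ∈ Aᶜ := Finset.mem_compl.mpr hi
    rw [← Finset.add_sum_erase _ _ hi', ← Finset.add_sum_erase _ _ hi']
    have hsum : ∑ j ∈ Aᶜ.erase i, min (m j) (Function.update a i (a i - 1) j) =
        ∑ j ∈ Aᶜ.erase i, min ((m + Finsupp.single i 1 : σ →₀ ℕ) j) (a j) := by
      refine Finset.sum_congr rfl fun j hj => ?_
      have hji := Finset.ne_of_mem_erase hj
      rw [Function.update_of_ne hji, Finsupp.add_apply, Finsupp.single_eq_of_ne hji, add_zero]
    rw [hsum, Function.update_self, Finsupp.add_apply, Finsupp.single_eq_same]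
    omega

theorem veroneseTypeIdeal_insert {A : Finset σ} {a : σ → ℕ} {D : ℕ} {i : σ} (hi : i ∉ A) :
    veroneseTypeIdeal K (insert i A) a D = veroneseTypeIdeal K A a D ⊔ Ideal.span {X i} := by
  have hcompl : ∀ m : σ →₀ ℕ, m i = 0 → ∑ j ∈ (insert i A)ᶜ, min (m j) (a j) =
      ∑ j ∈ Aᶜ, min (m j) (a j) := fun m hm => by
    rw [Finset.compl_insert, Finset.sum_erase]
    simp [hm]
  apply le_antisymm
  · intro f hf
    rw [f.as_sum]
    refine Ideal.sum_mem _ fun m hm => ?_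
    by_cases hmi : m i = 0
    · refine Ideal.mem_sup_left fun m' hm' => ?_
      obtain rfl : m' = m := Finset.mem_singleton.mp (support_monomial_subset hm')
      rcases hf hm with ⟨j, hj, hmj⟩ | h
      · rcases Finset.mem_insert.mp hj with rfl | hj
        · exact absurd hmi hmj
        · exact Or.inl ⟨j, hj, hmj⟩
      · exact Or.inr (h.trans_eq (hcompl _ hmi))
    · refine Ideal.mem_sup_right (Ideal.mem_span_singleton.mpr ?_)
      exact (X_dvd_monomial).mpr (Or.inr hmi)
  · refine sup_le (fun f hf m hm => ?_) ((Ideal.span_singleton_le_iff_mem _).mpr fun m hm => ?_)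
    · by_cases hmi : m i = 0
      · rcases hf hm with ⟨j, hj, hmj⟩ | h
        · exact Or.inl ⟨j, Finset.mem_insert_of_mem hj, hmj⟩
        · exact Or.inr (h.trans_eq (hcompl _ hmi).symm)
      · exact Or.inl ⟨i, Finset.mem_insert_self _ _, hmi⟩
    · obtain rfl : m = Finsupp.single i 1 := Finset.mem_singleton.mp (support_monomial_subset hm)
      exact Or.inl ⟨i, Finset.mem_insert_self _ _, by simp⟩

/-- Induction on the total bound `N`. The colon keeps `N - D` and `A`; adding `x_i` enlarges `A` by
one and lowers `N` by `a_i ≥ 1`, so `|A| + (N - D)` does not grow while `D ≤ N`. The extra `1` pays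
for the last variable added, when `N` falls below `D` and only the ideal of the variables in `A`
remains. -/
theorem isWeaklyRegular_quotient_veroneseTypeIdeal (s t N : ℕ) :
    ∀ (A : Finset σ) (a : σ → ℕ) (D : ℕ), ∑ i ∈ Aᶜ, a i = N → t + A.card ≤ Fintype.card σ →
      (D ≤ N → t + A.card + (N - D) + 1 ≤ Fintype.card σ) →
      IsWeaklyRegular (MvPolynomial σ K ⧸ veroneseTypeIdeal K A a D)
        ((List.range' s t).map (completeHomogeneous (X : σ → MvPolynomial σ K))) := by
  induction N using Nat.strong_induction_on with
  | _ N ih =>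
    intro A a D hN hA hD
    by_cases hlt : N < D
    · rw [veroneseTypeIdeal_eq_span_X_image (hN ▸ hlt)]
      exact isWeaklyRegular_quotient_span_X_image A s t hA
    cases D with
    | zero =>
      have htop : veroneseTypeIdeal K A a 0 = ⊤ :=
        Ideal.eq_top_iff_one _ |>.mpr fun m _ => Or.inr (Nat.zero_le _)
      have : Subsingleton (MvPolynomial σ K ⧸ veroneseTypeIdeal K A a 0) :=
        Ideal.Quotient.subsingleton_iff.mpr htop
      exact isWeaklyRegular_of_subsingleton _
    | succ D =>
      have hD' := hD (by omega)
      obtain ⟨i, hi, hai⟩ : ∃ i ∈ Aᶜ, a i ≠ 0 :=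
        Finset.exists_ne_zero_of_sum_ne_zero (by omega)
      have hiA := Finset.mem_compl.mp hi
      have hsplit := Finset.add_sum_erase _ a hi
      refine isWeaklyRegular_quotient_of_colon (mem_veroneseTypeIdeal_colon_X hiA hai)
        (veroneseTypeIdeal_insert hiA) ?_ ?_
      · refine ih (N - 1) (by omega) A _ D ?_ hA (fun _ => by omega)
        rw [← Finset.add_sum_erase _ _ hi, Function.update_self,
          Finset.sum_congr rfl fun j hj => Function.update_of_ne (Finset.ne_of_mem_erase hj) _ _]
        omega
      · refine ih (N - a i) (by omega) (insert i A) a (D + 1) ?_ ?_ ?_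
        · rw [Finset.compl_insert]; omega
        · rw [Finset.card_insert_of_notMem hiA]; omega
        · rw [Finset.card_insert_of_notMem hiA]; omega

end MonomialIdeals

/-! ### Powers of the squarefree Veronese ideal are of Veronese type. -/

section SquarefreeVeronese

variable {K : Type*} [Field K] {n d : ℕ}

theorem prod_X_eq_monomial_indicator {σ : Type*} (s : Finset σ) :
    (∏ i ∈ s, X i : MvPolynomial σ K) =
      monomial (Finsupp.indicator s fun _ _ => 1) 1 := by
  classical
  rw [monomial_eq, C_1, one_mul, Finsupp.prod_of_support_subset _
    (Finsupp.support_indicator_subset _ _) _ (fun _ _ => pow_zero _)]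
  refine Finset.prod_congr rfl fun i hi => ?_
  rw [Finsupp.indicator_of_mem hi, pow_one]

theorem sum_min_one_indicator {σ : Type*} [Fintype σ] [DecidableEq σ] (s : Finset σ) :
    ∑ i, min ((Finsupp.indicator s fun _ _ => 1 : σ →₀ ℕ) i) 1 = s.card := by
  rw [Finset.card_eq_sum_ones, ← Finset.sum_subset (Finset.subset_univ s)]
  · exact Finset.sum_congr rfl fun i hi => by rw [Finsupp.indicator_of_mem hi]; rfl
  · exact fun i _ hi => by rw [Finsupp.indicator_of_notMem hi]; rfl

theorem mem_veroneseExponents_empty {σ : Type*} [Fintype σ] [DecidableEq σ] {a : σ → ℕ} {D : ℕ}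
    {m : σ →₀ ℕ} : m ∈ veroneseExponents ∅ a D ↔ D ≤ ∑ i, min (m i) (a i) := by
  simp [veroneseExponents]

theorem squarefreeVeronese_pow_le (k : ℕ) :
    squarefreeVeronese K n d ^ k ≤ veroneseTypeIdeal K ∅ (fun _ => k) (k * d) := by
  induction k with
  | zero =>
    refine fun f _ m _ => mem_veroneseExponents_empty.mpr ?_
    rw [zero_mul]
    exact Nat.zero_le _
  | succ k ih =>
    rw [pow_succ]
    refine Ideal.mul_le.mpr fun f hf g hg => ?_
    refine Submodule.span_induction (p := fun g _ => f * g ∈ _) ?_ ?_ ?_ ?_ hg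
    · rintro _ ⟨s, hs, rfl⟩
      rw [prod_X_eq_monomial_indicator, veroneseTypeIdeal, mul_monomial_mem_restrictSupportIdeal]
      intro m hm
      have h := mem_veroneseExponents_empty.mp (ih hf hm)
      rw [mem_veroneseExponents_empty, add_mul, one_mul]
      refine (add_le_add h (hs ▸ (sum_min_one_indicator s).ge)).trans ?_
      rw [← Finset.sum_add_distrib]
      refine Finset.sum_le_sum fun i _ => ?_
      rw [Finsupp.add_apply]
      omega
    · rw [mul_zero]; exact zero_mem _
    · intro x y _ _ hx hy
      rw [mul_add]; exact add_mem hx hy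
    · intro a x _ hx
      rw [smul_eq_mul, mul_left_comm]; exact Ideal.mul_mem_left _ _ hx

/-- A `d`-subset of the support of a vector bounded by `k + 1` whose removal leaves enough room
to continue with bound `k`. -/
theorem exists_card_eq_and_le_sum_min {σ : Type*} [Fintype σ] [DecidableEq σ] {k d : ℕ}
    {m : σ → ℕ} (h : (k + 1) * d ≤ ∑ i, min (m i) (k + 1)) :
    ∃ s : Finset σ, s.card = d ∧ (∀ i ∈ s, m i ≠ 0) ∧
      k * d ≤ ∑ i, min (m i - if i ∈ s then 1 else 0) k := by
  let T : Finset σ := Finset.univ.filter fun i => k + 1 ≤ m i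
  let U : Finset σ := Finset.univ.filter fun i => m i ≠ 0
  have hTU : T ⊆ U := fun i hi => by
    simp only [T, U, Finset.mem_filter_univ] at hi ⊢
    omega
  have hU : d ≤ U.card := by
    have hle : ∑ i, min (m i) (k + 1) ≤ (k + 1) * U.card := by
      rw [mul_comm, ← smul_eq_mul, ← Finset.sum_const,
        ← Finset.sum_subset (Finset.subset_univ U) (f := fun i => min (m i) (k + 1))]
      · exact Finset.sum_le_sum fun i _ => min_le_right _ _
      · intro i _ hi
        have : m i = 0 := by simpa [U] using hi
        simp [this]
    exact Nat.le_of_mul_le_mul_left (h.trans hle) (Nat.succ_pos k)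
  -- `T` holds the coordinates where lowering the bound costs one. If `|T| ≤ d`, a set `s` between
  -- `T` and the support loses at most one per element of `s` and nothing elsewhere. If `|T| ≥ d`,
  -- any `s ⊆ T` works, since `T` alone still contributes `k |T| ≥ k d`.
  rcases le_total T.card d with hT | hT
  · obtain ⟨s, hTs, hsU, hs⟩ := Finset.exists_subsuperset_card_eq hTU hT hU
    have hsm : ∀ i ∈ s, m i ≠ 0 := fun i hi => by simpa [U] using hsU hi
    refine ⟨s, hs, hsm, ?_⟩
    have hsum : ∑ i, min (m i) (k + 1) ≤
        ∑ i, min (m i - if i ∈ s then 1 else 0) k + d := by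
      have hd : d = ∑ i, if i ∈ s then 1 else 0 := by simp [hs]
      rw [hd, ← Finset.sum_add_distrib]
      refine Finset.sum_le_sum fun i _ => ?_
      split_ifs with hi
      · have := hsm i hi; omega
      · have : ¬ k + 1 ≤ m i := fun h' => hi (hTs (by simpa [T] using h'))
        omega
    rw [add_mul, one_mul] at h
    omega
  · obtain ⟨s, hsT, hs⟩ := Finset.exists_subset_card_eq hT
    refine ⟨s, hs, fun i hi => by simpa [U] using hTU (hsT hi), ?_⟩
    calc k * d ≤ T.card * k := by rw [mul_comm]; exact Nat.mul_le_mul_right _ hT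
      _ = ∑ i ∈ T, k := by rw [Finset.sum_const, smul_eq_mul]
      _ ≤ ∑ i ∈ T, min (m i - if i ∈ s then 1 else 0) k := by
        refine Finset.sum_le_sum fun i hi => ?_
        have : k + 1 ≤ m i := by simpa [T] using hi
        split_ifs <;> omega
      _ ≤ _ := Finset.sum_le_sum_of_subset (Finset.subset_univ T)

theorem monomial_mem_squarefreeVeronese_pow (k : ℕ) :
    ∀ m : Fin n →₀ ℕ, k * d ≤ ∑ i, min (m i) k →
      (monomial m 1 : MvPolynomial (Fin n) K) ∈ squarefreeVeronese K n d ^ k := by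
  induction k with
  | zero => intros; simp
  | succ k ih =>
    intro m hm
    obtain ⟨s, hs, hsm, hle⟩ := exists_card_eq_and_le_sum_min hm
    let e : Fin n →₀ ℕ := Finsupp.indicator s fun _ _ => 1
    have he : ∀ i, e i = if i ∈ s then 1 else 0 := fun i => by
      simp [e, Finsupp.indicator_apply]
    have hadd : m = (m - e) + e := by
      refine (tsub_add_cancel_of_le fun i => ?_).symm
      rw [he]
      split_ifs with hi
      · exact Nat.one_le_iff_ne_zero.mpr (hsm i hi)
      · exact Nat.zero_le _
    have hmem : (monomial e 1 : MvPolynomial (Fin n) K) ∈ squarefreeVeronese K n d :=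
      Ideal.subset_span ⟨s, hs, (prod_X_eq_monomial_indicator s).symm⟩
    have hprod : (monomial m 1 : MvPolynomial (Fin n) K) = monomial (m - e) 1 * monomial e 1 := by
      rw [monomial_mul, mul_one, ← hadd]
    rw [hprod, pow_succ]
    refine Ideal.mul_mem_mul (ih _ ?_) hmem
    simpa only [Finsupp.tsub_apply, he] using hle

/-- The powers of the squarefree Veronese ideal are ideals of Veronese type. -/
theorem squarefreeVeronese_pow_eq (k : ℕ) :
    squarefreeVeronese K n d ^ k = veroneseTypeIdeal K ∅ (fun _ => k) (k * d) := by
  refine le_antisymm (squarefreeVeronese_pow_le k) fun f hf => ?_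
  rw [f.as_sum]
  refine Ideal.sum_mem _ fun m hm => ?_
  rw [← mul_one (coeff m f), ← C_mul_monomial]
  exact Ideal.mul_mem_left _ _ (monomial_mem_squarefreeVeronese_pow k m
    (mem_veroneseExponents_empty.mp (hf hm)))

/-! ### Associated primes generated by variables. -/

theorem exists_le_and_sum_eq {σ : Type*} [DecidableEq σ] (A : Finset σ) (c N : ℕ)
    (hN : N ≤ c * A.card) : ∃ v : σ → ℕ, (∀ i, v i ≤ c) ∧ ∑ i ∈ A, v i = N := by
  induction N with
  | zero => exact ⟨0, fun _ => Nat.zero_le _, by simp⟩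
  | succ N ih =>
    obtain ⟨v, hv, hsum⟩ := ih (by omega)
    obtain ⟨i, hi, hlt⟩ : ∃ i ∈ A, v i < c := by
      refine Finset.exists_lt_of_sum_lt (g := fun _ => c) ?_
      rw [Finset.sum_const, smul_eq_mul, hsum, mul_comm]
      omega
    refine ⟨v + Pi.single i 1, fun j => ?_, ?_⟩
    · by_cases hj : j = i
      · subst hj; simp; omega
      · simp [hj, hv j]
    · simp [Finset.sum_add_distrib, hsum, hi]

/-- The ideal generated by `a` variables is associated to an ideal of Veronese type with constant
bound `k + 1`, as soon as the degree condition for a socle monomial in these variables holds. -/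
theorem span_X_image_mem_associatedPrimes {σ : Type*} [Fintype σ] [DecidableEq σ] (A : Finset σ)
    {k D N : ℕ} (hD : N + 1 + (k + 1) * Aᶜ.card = D) (hN : N ≤ k * A.card) :
    Ideal.span (X '' (A : Set σ)) ∈ associatedPrimes (MvPolynomial σ K)
      (MvPolynomial σ K ⧸ veroneseTypeIdeal K ∅ (fun _ => k + 1) D) := by
  obtain ⟨v, hv, hsum⟩ := exists_le_and_sum_eq A k N hN
  -- Outside `A` the exponents already reach the cap, so further multiplication there changes
  -- nothing. Inside `A` they stay at most `k`, below the cap, and the truncated degree is `D - 1`;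
  -- a single variable from `A` therefore enters the ideal.
  let w : σ →₀ ℕ := Finsupp.equivFunOnFinite.symm fun i => if i ∈ A then v i else k + 1
  have hw : ∀ i, w i = if i ∈ A then v i else k + 1 := fun i => rfl
  refine isAssociatedPrime_iff.mpr ⟨isPrime_span_X_image A, Ideal.Quotient.mk _ (monomial w 1), ?_⟩
  ext f
  rw [Submodule.mem_colon_singleton, Submodule.mem_bot]
  change _ ↔ Ideal.Quotient.mk _ (f * monomial w 1) = 0
  rw [Ideal.Quotient.eq_zero_iff_mem, veroneseTypeIdeal, mul_monomial_mem_restrictSupportIdeal,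
    mem_ideal_span_X_image]
  refine forall₂_congr fun m _ => ?_
  have hsplit : ∑ i, min ((m + w) i) (k + 1) =
      ∑ i ∈ A, min (m i + v i) (k + 1) + (k + 1) * Aᶜ.card := by
    rw [← Finset.sum_add_sum_compl A, mul_comm (k + 1), ← smul_eq_mul, ← Finset.sum_const]
    congr 1
    · exact Finset.sum_congr rfl fun i hi => by rw [Finsupp.add_apply, hw, if_pos hi]
    · refine Finset.sum_congr rfl fun i hi => ?_
      rw [Finsupp.add_apply, hw, if_neg (Finset.mem_compl.mp hi)]
      omega
  rw [mem_veroneseExponents_empty, hsplit, ← hD, add_le_add_iff_right, Nat.succ_le_iff, ← hsum]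
  constructor
  · rintro ⟨i, hi, hmi⟩
    refine Finset.sum_lt_sum (fun j _ => ?_) ⟨i, hi, ?_⟩
    · have := hv j; omega
    · have := hv i; omega
  · intro hlt
    obtain ⟨i, hi, h⟩ := Finset.exists_lt_of_sum_lt hlt
    exact ⟨i, hi, by omega⟩

/-! ### The two bounds on the depth. -/

theorem gradedMaximalIdeal_eq_span_image_univ :
    gradedMaximalIdeal K n = Ideal.span (X '' ((Finset.univ : Finset (Fin n)) : Set (Fin n))) := by
  rw [Finset.coe_univ, Set.image_univ, gradedMaximalIdeal]

theorem isPrime_gradedMaximalIdeal : (gradedMaximalIdeal K n).IsPrime := by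
  rw [gradedMaximalIdeal_eq_span_image_univ]
  exact isPrime_span_X_image _

theorem squarefreeVeronese_le_gradedMaximalIdeal (hd : d ≠ 0) :
    squarefreeVeronese K n d ≤ gradedMaximalIdeal K n := by
  refine Ideal.span_le.mpr ?_
  rintro _ ⟨s, hs, rfl⟩
  obtain ⟨i, hi⟩ : s.Nonempty := Finset.card_ne_zero.mp (hs ▸ hd)
  have hX : X i ∈ gradedMaximalIdeal K n := Ideal.subset_span (Set.mem_range_self i)
  exact Ideal.mem_of_dvd _ (Finset.dvd_prod_of_mem X hi) hX

open RingTheory.Sequence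

theorem top_ne_ofList_smul_quotient {R : Type*} [CommRing R] {I m : Ideal R} (hm : m ≠ ⊤)
    (hI : I ≤ m) {rs : List R} (hrs : ∀ r ∈ rs, r ∈ m) :
    (⊤ : Submodule R (R ⧸ I)) ≠ Ideal.ofList rs • ⊤ := by
  intro h
  have hle : Ideal.ofList rs ≤ m := Ideal.span_le.mpr hrs
  let g : (R ⧸ I) →ₗ[R] (R ⧸ m) := Submodule.mapQ I m LinearMap.id hI
  have hg : ∀ y ∈ Ideal.ofList rs • (⊤ : Submodule R (R ⧸ I)), g y = 0 := by
    refine fun y hy => Submodule.smul_induction_on hy (fun r hr z _ => ?_) fun y z hy hz => ?_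
    · obtain ⟨z, rfl⟩ := Submodule.Quotient.mk_surjective _ z
      exact (Submodule.Quotient.mk_eq_zero m).mpr (m.mul_mem_right _ (hle hr))
    · rw [map_add, hy, hz, add_zero]
  have h1 : g (Submodule.Quotient.mk 1) = 0 := hg _ (h ▸ Submodule.mem_top)
  exact hm ((Ideal.eq_top_iff_one _).mpr ((Submodule.Quotient.mk_eq_zero m).mp h1))

theorem le_depth_quotient_squarefreeVeronese_pow {e k t : ℕ} (hd : d ≠ 0) (hk : k ≠ 0)
    (hn : n = d + e) (ht : t + k * e + 1 ≤ n) :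
    (t : ℕ∞) ≤ depth K n (MvPolynomial (Fin n) K ⧸ squarefreeVeronese K n d ^ k) := by
  -- The indices start at `1`: the term of index `0` is the unit `1`.
  let rs := (List.range' 1 t).map
    (completeHomogeneous (X : Fin n → MvPolynomial (Fin n) K))
  have hrs : ∀ r ∈ rs, r ∈ gradedMaximalIdeal K n := by
    intro r hr
    obtain ⟨j, hj, rfl⟩ := List.mem_map.mp hr
    obtain ⟨j, rfl⟩ : ∃ i, j = i + 1 := ⟨j - 1, by rw [List.mem_range'_1] at hj; omega⟩
    exact completeHomogeneous_mem (fun i => Ideal.subset_span (Set.mem_range_self i)) j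
  have hreg : IsRegular (MvPolynomial (Fin n) K ⧸ squarefreeVeronese K n d ^ k) rs := by
    refine ⟨?_, top_ne_ofList_smul_quotient isPrime_gradedMaximalIdeal.ne_top
      ((Ideal.pow_le_self hk).trans (squarefreeVeronese_le_gradedMaximalIdeal hd)) hrs⟩
    rw [squarefreeVeronese_pow_eq]
    refine isWeaklyRegular_quotient_veroneseTypeIdeal 1 t (n * k) ∅ _ (k * d) ?_ ?_ fun _ => ?_
    · simp
    · simp; omega
    -- Initially `N - D = n k - k d = k e` and `A` is empty, so the required inequality is exactly
    -- `ht`.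
    · have : n * k = k * d + k * e := by rw [hn]; ring
      simp; omega
  have hlen : rs.length = t := by simp [rs]
  rw [← hlen]
  exact le_iSup₂_of_le rs ⟨hrs, hreg⟩ le_rfl

/-- The socle monomial needs `N = (k + 1)(a - e) - 1` with `0 ≤ N ≤ k a`, that is `e < a ≤ (k + 1) e
+ 1`. The largest such `a ≤ n` gives the smallest dimension `n - a`. -/
theorem depth_quotient_squarefreeVeronese_pow_le {e k a : ℕ} (hd : d ≠ 0) (he : e ≠ 0)
    (hn : n = d + e) (ha : a = min n ((k + 1) * e + 1)) :
    depth K n (MvPolynomial (Fin n) K ⧸ squarefreeVeronese K n d ^ (k + 1)) ≤ (n - a : ℕ) := by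
  obtain ⟨A, -, hA⟩ := Finset.exists_subset_card_eq
    (s := (Finset.univ : Finset (Fin n))) (n := a) (by simp [ha])
  have hAc : Aᶜ.card + a = n := by
    rw [← hA, add_comm, Finset.card_add_card_compl, Fintype.card_fin]
  obtain ⟨N, hN⟩ : ∃ N, N + 1 + (k + 1) * Aᶜ.card = (k + 1) * d := by
    refine ⟨(k + 1) * d - (k + 1) * Aᶜ.card - 1, ?_⟩
    have hlt : (k + 1) * Aᶜ.card < (k + 1) * d := by
      refine Nat.mul_lt_mul_of_pos_left ?_ (Nat.succ_pos k)
      have : e ≤ (k + 1) * e := Nat.le_mul_of_pos_left e (Nat.succ_pos k)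
      omega
    omega
  have hNle : N ≤ k * A.card := by
    have h1 : (k + 1) * Aᶜ.card + (k + 1) * a = (k + 1) * d + (k + 1) * e := by
      rw [← mul_add, ← mul_add, hAc, hn]
    have h2 : (k + 1) * a = k * a + a := by ring
    rw [hA]
    omega
  have hass := span_X_image_mem_associatedPrimes (K := K) A hN hNle
  rw [← squarefreeVeronese_pow_eq] at hass
  refine iSup₂_le fun rs hrs => ?_
  have hle : Ideal.span (X '' (A : Set (Fin n))) ≤ gradedMaximalIdeal K n :=
    Ideal.span_mono (Set.image_subset_range _ _)
  have h := length_le_ringKrullDim_quotient_of_isWeaklyRegular isPrime_gradedMaximalIdeal hass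
    hle hrs.1 hrs.2.toIsWeaklyRegular
  rw [ringKrullDim_quotient_span_X_image, Fintype.card_fin, hA] at h
  exact WithBot.coe_le_coe.mp h

end SquarefreeVeronese

theorem corollary3p3 (K : Type*) [Field K] (n d : ℕ) (hd : 2 ≤ d) (hdn : d < n)
    (k : ℕ) (hk : 1 ≤ k) :
    depth K n (MvPolynomial (Fin n) K ⧸ squarefreeVeronese K n d ^ k) =
      ((max 0 ((n : ℤ) - (k : ℤ) * ((n : ℤ) - (d : ℤ)) - 1)).toNat : ℕ∞) := by
  obtain ⟨e, rfl⟩ := Nat.exists_eq_add_of_lt hdn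
  obtain ⟨k, rfl⟩ := Nat.exists_eq_add_of_le' hk
  have hval : (max 0 (((d + e + 1 : ℕ) : ℤ) - ((k + 1 : ℕ) : ℤ) *
      (((d + e + 1 : ℕ) : ℤ) - (d : ℤ)) - 1)).toNat =
        d + e + 1 - min (d + e + 1) ((k + 1) * (e + 1) + 1) := by
    have : ((k + 1 : ℕ) : ℤ) * (((d + e + 1 : ℕ) : ℤ) - (d : ℤ)) =
        (((k + 1) * (e + 1) : ℕ) : ℤ) := by push_cast; ring
    rw [this]
    omega
  rw [hval]
  refine le_antisymm
    (depth_quotient_squarefreeVeronese_pow_le (e := e + 1) (by omega) (by omega) (by omega) rfl) ?_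
  rcases le_total (d + e + 1) ((k + 1) * (e + 1) + 1) with h | h
  · rw [min_eq_left h, Nat.sub_self, Nat.cast_zero]
    exact zero_le
  · rw [min_eq_right h]
    exact le_depth_quotient_squarefreeVeronese_pow (e := e + 1) (by omega) (by omega) (by omega)
      (by omega)
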